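/- All graphs are finite and simple. A tree decomposition of a graph $G$ is a pair $(T,\beta)$ where $T$ is a tree and $\beta$ assigns to each vertex $x$ of $T$ a set $\beta(x)\subseteq V(G)$ such that for every $v\in V(G)$ the subgraph of $T$ induced by $\{x\in V(T): v\in\beta(x)\}$ is non-null and connected, and for every edge $uv$ of $G$ there is $x\in V(T)$ with $u,v\in\beta(x)$. The treewidth $\mathrm{tw}(G)$ is the minimum integer $w\ge 0$ for which $G$ has a tree decomposition $(T,\beta)$ with $|\beta(x)|\le w+1$ for all $x\in V(T)$; the pathwidth $\mathrm{pw}(G)$ is defined in the same way, with $T$ required to be a path. A graph $G$ has an induced minor isomorphic to a graph $H$ if there are pairwise disjoint sets $X_v\subseteq V(G)$, $v\in V(H)$, each inducing a non-null connected subgraph of $G$, such that for all distinct $u,v\in V(H)$ there is an edge of $G$ between $X_u$ and $X_v$ if and only if $uv\in E(H)$. For an integer $r\ge 0$, let $B_r$ be the full binary tree of radius $r$, that is, the rooted tree with $2^{r+1}-1$ vertices in which every vertex at distance less than $r$ from the root has exactly two children and every vertex at distance $r$ from the root is a leaf. Theorem. For all positive integers $\rho,\tau$, every graph $G$ with $\mathrm{tw}(G)<\tau$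 and with no induced minor isomorphic to $B_\rho$ satisfies $\mathrm{pw}(G)<\tau^{6\rho+2}$. -/

import Mathlib

namespace SimpleGraph

/-- `(T, β)` is a tree decomposition of `G`: `T` is a tree, for every vertex `v` of `G` the subgraph
of `T` induced by the nodes whose bag contains `v` is non-null and connected (Mathlib's `Connected`
includes non-emptiness), and every edge of `G` lies in some bag. -/
structure IsTreeDecomposition {V ι : Type*} (G : SimpleGraph V) (T : SimpleGraph ι)
    (β : ι → Finset V) : Prop where
  isTree : T.IsTree
  connected : ∀ v : V, (T.induce {x | v ∈ β x}).Connected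
  exists_bag : ∀ u v : V, G.Adj u v → ∃ x, u ∈ β x ∧ v ∈ β x

/-- A path decomposition is a tree decomposition `(T, β)` where `T` is a path. -/
structure IsPathDecomposition {V ι : Type*} (G : SimpleGraph V) (T : SimpleGraph ι)
    (β : ι → Finset V) : Prop extends IsTreeDecomposition G T β where
  isPath : ∃ n : ℕ, Nonempty (T ≃g pathGraph n)

/-- `G` has a tree decomposition over a finite tree, all of whose bags have at most `w + 1`
elements. Up to isomorphism, the node set of a finite tree is `Fin n`. -/
def HasTreewidthAtMost {V : Type*} (G : SimpleGraph V) (w : ℕ) : Prop :=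
  ∃ (n : ℕ) (T : SimpleGraph (Fin n)) (β : Fin n → Finset V),
    G.IsTreeDecomposition T β ∧ ∀ x, (β x).card ≤ w + 1

/-- `G` has a path decomposition over a finite path, all of whose bags have at most `w + 1`
elements. -/
def HasPathwidthAtMost {V : Type*} (G : SimpleGraph V) (w : ℕ) : Prop :=
  ∃ (n : ℕ) (T : SimpleGraph (Fin n)) (β : Fin n → Finset V),
    G.IsPathDecomposition T β ∧ ∀ x, (β x).card ≤ w + 1

/-- The treewidth of a finite graph, as a natural number. The minimum exists for finite graphs
(see `hasTreewidthAtMost_treewidth`). -/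
noncomputable def treewidth {V : Type*} (G : SimpleGraph V) : ℕ :=
  sInf {w : ℕ | G.HasTreewidthAtMost w}

/-- The pathwidth of a finite graph, as a natural number. The minimum exists for finite graphs
(see `hasPathwidthAtMost_pathwidth`). -/
noncomputable def pathwidth {V : Type*} (G : SimpleGraph V) : ℕ :=
  sInf {w : ℕ | G.HasPathwidthAtMost w}

/-- `(X v : v ∈ V(H))` is an induced `H`-model in `G`: the sets `X v` are pairwise disjoint and
induce non-null connected subgraphs of `G`, and for distinct vertices `u, v` of `H`, there is an
edge of `G` between `X u` and `X v` if and only if `uv` is an edge of `H`. -/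
structure IsInducedModel {W V : Type*} (H : SimpleGraph W) (G : SimpleGraph V)
    (X : W → Set V) : Prop where
  connected : ∀ v : W, (G.induce (X v)).Connected
  disjoint : ∀ u v : W, u ≠ v → Disjoint (X u) (X v)
  adj_iff : ∀ u v : W, u ≠ v → (H.Adj u v ↔ ∃ x ∈ X u, ∃ y ∈ X v, G.Adj x y)

/-- `G` has an induced minor isomorphic to `H`. -/
def HasInducedMinor {V W : Type*} (G : SimpleGraph V) (H : SimpleGraph W) : Prop :=
  ∃ X : W → Set V, H.IsInducedModel G X

/-- The full binary tree of radius `r`: the nodes are the binary words of length at most `r`, the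
root is the empty word, and the children of a word `w` of length less than `r` are `b :: w` for
`b` a letter. It has `2 ^ (r + 1) - 1` vertices, and all leaves are at distance `r` from the
root. -/
def binaryTree (r : ℕ) : SimpleGraph {w : List Bool // w.length ≤ r} where
  Adj u v := (∃ b : Bool, v.1 = b :: u.1) ∨ (∃ b : Bool, u.1 = b :: v.1)
  symm := ⟨fun _ _ h => h.symm⟩
  loopless := ⟨fun u h => by
    rcases h with ⟨b, hb⟩ | ⟨b, hb⟩ <;> simpa using congrArg List.length hb⟩

/-- A finite graph has a path decomposition with a single bag. -/
theorem exists_hasPathwidthAtMost {V : Type*} [Finite V] (G : SimpleGraph V) :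
    ∃ w, G.HasPathwidthAtMost w := by
  classical
  have := Fintype.ofFinite V
  refine ⟨Fintype.card V, 1, pathGraph 1, fun _ => Finset.univ, ⟨⟨⟨?_, ?_⟩, ?_, ?_⟩, ?_⟩, ?_⟩
  · exact pathGraph_connected 0
  · exact IsAcyclic.of_subsingleton
  · intro v
    have : Nonempty {x : Fin 1 | v ∈ (Finset.univ : Finset V)} := ⟨⟨0, by simp⟩⟩
    exact ⟨fun a b => by rw [Subsingleton.elim a b]⟩
  · intro u v _
    exact ⟨0, by simp, by simp⟩
  · exact ⟨1, ⟨Iso.refl⟩⟩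
  · intro x
    simp

theorem HasPathwidthAtMost.hasTreewidthAtMost {V : Type*} {G : SimpleGraph V} {w : ℕ}
    (h : G.HasPathwidthAtMost w) : G.HasTreewidthAtMost w := by
  obtain ⟨n, T, β, hT, hw⟩ := h
  exact ⟨n, T, β, hT.toIsTreeDecomposition, hw⟩

theorem hasPathwidthAtMost_pathwidth {V : Type*} [Finite V] (G : SimpleGraph V) :
    G.HasPathwidthAtMost G.pathwidth :=
  Nat.sInf_mem (s := {w : ℕ | G.HasPathwidthAtMost w}) G.exists_hasPathwidthAtMost

theorem hasTreewidthAtMost_treewidth {V : Type*} [Finite V] (G : SimpleGraph V) :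
    G.HasTreewidthAtMost G.treewidth :=
  Nat.sInf_mem (s := {w : ℕ | G.HasTreewidthAtMost w})
    (G.exists_hasPathwidthAtMost.imp fun _ h => h.hasTreewidthAtMost)

end SimpleGraph

/-! Root a tree decomposition and rank vertices by decreasing depth of their top bag. Then each
component `G.lower f x` of `x` among the vertices of rank at most `f x` has fewer than `τ` outside
neighbours. These sets are laminar, and disjoint ones have no edges between them. Pathwidth is
bounded through vertex separation number; call a set `s`-heavy if it has no layout of width `s`.

The core is a dichotomy (`hasLayout_lower_of_not_hasBranching`): if a set `lower` is `(s +
6τ)`-heavy, then from any prescribed vertex `z` of it some connected set branches to two disjoint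
`s`-heavy sets `lower` inside it. Iterating from a `6τN`-heavy set gives a binary tree of `N` levels
of connected sets (`exists_isBranchSystem`), in which incomparable nodes have no edges between them.
Unwanted edges can only join a node to a remote ancestor.

These are avoided by counting: the set at a node has fewer than `τ` outside neighbours, so it sees
fewer than `τ` ancestors. By pigeonhole, among `τ * n` levels some block of `n` levels has all its
exits extending to nodes that see nothing in the block (`exists_unseen_block`). Induction on the
radius then finds the full binary tree of radius `ρ` within `1 + τ + ... + τ^ρ` levels. So the
pathwidth is at most `6τ` times this sum, which is small enough when `τ ≥ 2`; for `τ = 1` the graph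
is edgeless. -/

namespace SimpleGraph

/-! ### Linear layouts and vertex separation. -/

/-- The vertices of `W` with a neighbour in `Z \ W`. -/
def frontierIn {V : Type*} (G : SimpleGraph V) (Z W : Set V) : Set V :=
  {v | v ∈ W ∧ ∃ u ∈ Z, u ∉ W ∧ G.Adj v u}

/-- `W` can be built up vertex by vertex inside `Z` so that all intermediate sets have at most `k`
vertices with a neighbour in the rest of `Z`. -/
inductive Sweep {V : Type*} (G : SimpleGraph V) (Z : Set V) (k : ℕ) : Set V → Prop
  | empty : Sweep G Z k ∅
  | insert {W : Set V} {v : V} : Sweep G Z k W → v ∈ Z →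
      (G.frontierIn Z (insert v W)).ncard ≤ k → Sweep G Z k (insert v W)

/-- `Z` has a linear layout of vertex separation number at most `k`. -/
def HasLayout {V : Type*} (G : SimpleGraph V) (Z : Set V) (k : ℕ) : Prop :=
  G.Sweep Z k Z

section Sweep

variable {V : Type*} [Finite V] {G : SimpleGraph V} {Z Z' W P P' Y : Set V} {k κ : ℕ}

theorem Sweep.restrict (hZ : Z' ⊆ Z) (h : G.Sweep Z k W) : G.Sweep Z' k (W ∩ Z') := by
  induction h with
  | empty => simpa using Sweep.empty
  | @insert W v _ _ hk ih =>
    by_cases hv : v ∈ Z'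
    · rw [Set.insert_inter_of_mem hv]
      refine ih.insert hv (le_trans (Set.ncard_le_ncard ?_ (Set.toFinite _)) hk)
      rintro a ⟨ha, u, hu, hua, hadj⟩
      rw [← Set.insert_inter_of_mem hv] at ha hua
      exact ⟨ha.1, u, hZ hu, fun h => hua ⟨h, hu⟩, hadj⟩
    · rwa [Set.insert_inter_of_notMem hv]

theorem HasLayout.subset (hZ : Z' ⊆ Z) (h : G.HasLayout Z k) : G.HasLayout Z' k := by
  have := Sweep.restrict hZ h
  rwa [Set.inter_eq_right.2 hZ] at this

/-- Adding vertices of `Y` to `P` keeps the frontier inside `Y`. -/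
theorem Sweep.union_of_subset (h : G.Sweep Z κ P) (hY : G.frontierIn Z P ⊆ Y)
    (hκ : Y.ncard ≤ κ) (Y' : Set V) (hY' : Y' ⊆ Y) (hZ : Y' ⊆ Z) : G.Sweep Z κ (P ∪ Y') := by
  induction Y', Set.toFinite Y' using Set.Finite.induction_on with
  | empty => simpa using h
  | @insert a s _ _ ih =>
    rw [Set.insert_subset_iff] at hY' hZ
    rw [Set.union_insert]
    refine (ih hY'.2 hZ.2).insert hZ.1 (le_trans (Set.ncard_le_ncard ?_ (Set.toFinite _)) hκ)
    rintro v ⟨hv, u, hu, huv, hadj⟩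
    rcases hv with rfl | hv | hv
    · exact hY'.1
    · exact hY ⟨hv, u, hu, fun h => huv (Or.inr (Or.inl h)), hadj⟩
    · exact hY'.2 hv

/-- Add `Y ∩ P'` first and count `Y` as active throughout. Every other active vertex is then active
in the layout of `(P' \ P) \ Y`, so the two widths add up. -/
theorem Sweep.extend (h : G.Sweep Z κ P) (hP : P ⊆ P') (hP' : P' ⊆ Z)
    (hY : G.frontierIn Z P ⊆ Y) (hY' : G.frontierIn Z P' ⊆ Y) (hκ : Y.ncard + k ≤ κ)
    (hL : G.HasLayout ((P' \ P) \ Y) k) : G.Sweep Z κ P' := by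
  have key : ∀ W, G.Sweep ((P' \ P) \ Y) k W →
      W ⊆ (P' \ P) \ Y ∧ G.Sweep Z κ (P ∪ (Y ∩ P') ∪ W) := by
    intro W hW
    induction hW with
    | empty =>
      refine ⟨Set.empty_subset _, ?_⟩
      rw [Set.union_empty]
      exact h.union_of_subset hY (by omega) _ Set.inter_subset_left
        (Set.inter_subset_right.trans hP')
    | @insert W a _ ha hk ih =>
      refine ⟨Set.insert_subset ha ih.1, ?_⟩
      rw [Set.union_insert]
      refine ih.2.insert (hP' ha.1.1) (le_trans (Set.ncard_le_ncard (t := Y ∪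
        G.frontierIn ((P' \ P) \ Y) (Insert.insert a W)) ?_ (Set.toFinite _)) ?_)
      · rintro v ⟨hv, u, hu, huv, hadj⟩
        simp only [Set.mem_insert_iff, Set.mem_union, Set.mem_inter_iff, not_or] at hv huv
        by_cases hvP : v ∈ P
        · exact Or.inl (hY ⟨hvP, u, hu, huv.2.1.1, hadj⟩)
        by_cases hvY : v ∈ Y
        · exact Or.inl hvY
        have hvW : v ∈ Insert.insert a W := by
          simp only [Set.mem_insert_iff]; tauto
        by_cases huP : u ∈ P'
        · refine Or.inr ⟨hvW, u, ⟨⟨huP, huv.2.1.1⟩, fun h => huv.2.1.2 ⟨h, huP⟩⟩, ?_, hadj⟩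
          simp only [Set.mem_insert_iff]; tauto
        · refine Or.inl (hY' ⟨?_, u, hu, huP, hadj⟩)
          exact (Set.insert_subset ha ih.1 hvW).1.1
      · exact (Set.ncard_union_le _ _).trans (by omega)
  have := (key _ hL).2
  convert this using 1
  ext v
  have := @hP v
  simp only [Set.mem_union, Set.mem_inter_iff, Set.mem_sdiff]
  tauto

end Sweep

/-! ### Components and connected sets. -/

/-- The vertex set of the connected component of `z` in the subgraph induced by `B`. -/
def compIn {V : Type*} (G : SimpleGraph V) (B : Set V) (z : V) : Set V :=
  {y | z ∈ B ∧ Relation.ReflTransGen (fun a b => G.Adj a b ∧ b ∈ B) z y}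

/-- No proper non-empty part of `C` is closed under adjacency within `C`. -/
def IsConn {V : Type*} (G : SimpleGraph V) (C : Set V) : Prop :=
  ∀ D : Set V, (∃ a ∈ C, a ∈ D) → (∀ a ∈ C, a ∈ D → ∀ b ∈ C, G.Adj a b → b ∈ D) → C ⊆ D

section Conn

variable {V : Type*} {G : SimpleGraph V} {B B' C D : Set V} {x y z u : V}

theorem compIn_subset : G.compIn B z ⊆ B := by
  rintro y ⟨hz, h⟩
  cases h with
  | refl => exact hz
  | tail _ h => exact h.2

theorem mem_compIn_self (hz : z ∈ B) : z ∈ G.compIn B z := ⟨hz, .refl⟩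

theorem mem_of_mem_compIn (h : y ∈ G.compIn B z) : z ∈ B := h.1

theorem compIn_closed (h : y ∈ G.compIn B z) (hadj : G.Adj y u) (hu : u ∈ B) :
    u ∈ G.compIn B z := ⟨h.1, h.2.tail ⟨hadj, hu⟩⟩

theorem compIn_subset_of_closed (hz : z ∈ D)
    (hD : ∀ a ∈ G.compIn B z, a ∈ D → ∀ b ∈ B, G.Adj a b → b ∈ D) : G.compIn B z ⊆ D := by
  rintro y ⟨hzB, h⟩
  induction h with
  | refl => exact hz
  | @tail b c hb hbc ih => exact hD b ⟨hzB, hb⟩ ih c hbc.2 hbc.1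

theorem compIn_isConn : G.IsConn (G.compIn B z) := by
  rintro D ⟨a, ha, haD⟩ hD
  have hz : z ∈ D := by
    by_contra hz
    have : G.compIn B z ⊆ {v | v ∉ D} := by
      refine compIn_subset_of_closed hz fun u hu huD v hv hadj hvD => huD ?_
      exact hD v (compIn_closed hu hadj hv) hvD u hu hadj.symm
    exact this ha haD
  exact compIn_subset_of_closed hz fun a ha haD b hb hadj =>
    hD a ha haD b (compIn_closed ha hadj hb) hadj

theorem IsConn.subset_compIn (hC : G.IsConn C) (hB : C ⊆ B) (hu : u ∈ C)
    (huz : u ∈ G.compIn B z) : C ⊆ G.compIn B z :=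
  hC _ ⟨u, hu, huz⟩ fun _ _ haD _ hb hadj => compIn_closed haD hadj (hB hb)

theorem compIn_mono (hB : B ⊆ B') : G.compIn B z ⊆ G.compIn B' z :=
  fun _ h => ⟨hB h.1, Relation.ReflTransGen.mono (fun _ _ h => ⟨h.1, hB h.2⟩) _ _ h.2⟩

theorem IsConn.union (hB : G.IsConn B) (hC : G.IsConn C) (hx : x ∈ B) (hy : y ∈ C)
    (hxy : G.Adj x y) : G.IsConn (B ∪ C) := by
  rintro D ⟨a, ha, haD⟩ hD
  have h1 : (∃ a ∈ B, a ∈ D) → B ⊆ D := fun h => hB D h fun a ha haD b hb =>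
    hD a (Or.inl ha) haD b (Or.inl hb)
  have h2 : (∃ a ∈ C, a ∈ D) → C ⊆ D := fun h => hC D h fun a ha haD b hb =>
    hD a (Or.inr ha) haD b (Or.inr hb)
  rcases ha with ha | ha
  · have := h1 ⟨a, ha, haD⟩
    exact Set.union_subset this
      (h2 ⟨y, hy, hD x (Or.inl hx) (this hx) y (Or.inr hy) hxy⟩)
  · have := h2 ⟨a, ha, haD⟩
    exact Set.union_subset
      (h1 ⟨x, hx, hD y (Or.inr hy) (this hy) x (Or.inl hx) hxy.symm⟩) this

theorem IsConn.induce_connected (hC : G.IsConn C) (hz : z ∈ C) : (G.induce C).Connected := by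
  have : Nonempty C := ⟨⟨z, hz⟩⟩
  have key : C ⊆ {v | ∃ h : v ∈ C, (G.induce C).Reachable ⟨z, hz⟩ ⟨v, h⟩} := by
    refine hC _ ⟨z, hz, hz, Reachable.refl _⟩ ?_
    rintro a _ ⟨ha, hr⟩ b hb hadj
    exact ⟨hb, hr.trans (Adj.reachable (by simpa using hadj))⟩
  rw [connected_iff_exists_forall_reachable]
  exact ⟨⟨z, hz⟩, fun v => (key v.2).2⟩

end Conn

/-! ### The laminar family given by a ranking. -/

/-- The component of `x` in the subgraph induced by the vertices of rank at most `f x`. -/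
def lower {V : Type*} (G : SimpleGraph V) (f : V → ℕ) (x : V) : Set V :=
  G.compIn {v | f v ≤ f x} x

/-- The neighbours of `G.lower f x` outside it. -/
def attach {V : Type*} (G : SimpleGraph V) (f : V → ℕ) (x : V) : Set V :=
  {u | u ∉ G.lower f x ∧ ∃ v ∈ G.lower f x, G.Adj v u}

section Lower

variable {V : Type*} {G : SimpleGraph V} {f : V → ℕ} {x y u a w : V}

theorem mem_lower_self : x ∈ G.lower f x := mem_compIn_self (le_refl (f x))

theorem rank_le_of_mem_lower (h : y ∈ G.lower f x) : f y ≤ f x :=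
  (compIn_subset h : y ∈ {v | f v ≤ f x})

theorem lower_closed (h : y ∈ G.lower f x) (hadj : G.Adj y u) (hu : f u ≤ f x) :
    u ∈ G.lower f x := compIn_closed h hadj hu

theorem lower_isConn : G.IsConn (G.lower f x) := compIn_isConn

theorem mem_lower_of_mem_of_mem (hx : a ∈ G.lower f x) (hy : a ∈ G.lower f y)
    (h : f x ≤ f y) : G.lower f x ⊆ G.lower f y :=
  lower_isConn.subset_compIn (fun _ hb => (rank_le_of_mem_lower hb).trans h) hx hy

theorem lower_subset_of_mem (h : y ∈ G.lower f x) : G.lower f y ⊆ G.lower f x :=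
  mem_lower_of_mem_of_mem mem_lower_self h (rank_le_of_mem_lower h)

theorem attach_subset (h : G.lower f x ⊆ G.lower f y) :
    G.attach f x ⊆ G.lower f y ∪ G.attach f y := by
  rintro u ⟨_, v, hv, hadj⟩
  by_cases hu : u ∈ G.lower f y
  · exact Or.inl hu
  · exact Or.inr ⟨hu, v, h hv, hadj⟩

/-- Two sets `lower` are nested or disjoint. -/
theorem lower_disjoint (hx : x ∉ G.lower f y) (hy : y ∉ G.lower f x) :
    Disjoint (G.lower f x) (G.lower f y) := by
  rw [Set.disjoint_left]
  intro a ha ha'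
  rcases le_total (f x) (f y) with h | h
  · exact hx (mem_lower_of_mem_of_mem ha ha' h mem_lower_self)
  · exact hy (mem_lower_of_mem_of_mem ha' ha h mem_lower_self)

theorem not_adj_of_lower_disjoint (h : Disjoint (G.lower f x) (G.lower f y))
    (hu : u ∈ G.lower f x) (ha : a ∈ G.lower f y) : ¬ G.Adj u a := by
  intro hadj
  rw [Set.disjoint_left] at h
  rcases le_total (f x) (f y) with hxy | hxy
  · exact h hu (lower_closed ha hadj.symm ((rank_le_of_mem_lower hu).trans hxy))
  · exact h (lower_closed hu hadj ((rank_le_of_mem_lower ha).trans hxy)) ha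

end Lower

/-! ### Branching inside a set of the family. -/

section Branching

variable {V : Type*} {G : SimpleGraph V} {f : V → ℕ} {s : ℕ} {x z : V}

/-- Descending from `G.lower f x`, a connected set through `z` that branches to two disjoint sets
`lower` of large vertex separation number. -/
def HasBranching {V : Type*} (G : SimpleGraph V) (f : V → ℕ) (s : ℕ) (x z : V) : Prop :=
  ∃ (y : Bool → V) (t : Bool → V) (R : Set V), G.IsConn R ∧ z ∈ R ∧ R ⊆ G.lower f x ∧
    (∀ b, G.lower f (y b) ⊆ G.lower f x) ∧ Disjoint (G.lower f (y true)) (G.lower f (y false)) ∧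
    (∀ b, Disjoint R (G.lower f (y b))) ∧ (∀ b, ¬ G.HasLayout (G.lower f (y b)) s) ∧
    ∀ b, t b ∈ G.lower f (y b) ∧ ∃ r ∈ R, G.Adj r (t b)

/-- Otherwise deleting `C` as well would not shrink the component of `z`, which would then miss `C`.
-/
theorem exists_adj_compIn {S B C : Set V} (hz : z ∈ S \ (B ∪ C))
    (hC : (C ∩ G.compIn (S \ B) z).Nonempty) :
    ∃ r ∈ G.compIn (S \ (B ∪ C)) z, ∃ t ∈ C, G.Adj r t := by
  by_contra! hcon
  have : G.compIn (S \ B) z ⊆ G.compIn (S \ (B ∪ C)) z := by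
    refine compIn_subset_of_closed (mem_compIn_self hz) fun a _ ha b hb hadj => ?_
    refine compIn_closed ha hadj ⟨hb.1, ?_⟩
    rintro (h | h)
    · exact hb.2 h
    · exact hcon a ha b h hadj
  obtain ⟨c, hc, hc'⟩ := hC
  exact (compIn_subset (this hc')).2 (Or.inr hc)

/-- The component of `z` outside both sets serves as `R`: each set is reachable from `z` while
avoiding the other, hence is adjacent to `R`. -/
theorem hasBranching_of_nonempty {y y' : V} (hy : G.lower f y ⊆ G.lower f x)
    (hy' : G.lower f y' ⊆ G.lower f x) (hd : Disjoint (G.lower f y) (G.lower f y'))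
    (hh : ¬ G.HasLayout (G.lower f y) s) (hh' : ¬ G.HasLayout (G.lower f y') s)
    (h1 : (G.lower f y ∩ G.compIn (G.lower f x \ G.lower f y') z).Nonempty)
    (h2 : (G.lower f y' ∩ G.compIn (G.lower f x \ G.lower f y) z).Nonempty) :
    G.HasBranching f s x z := by
  have hz' := mem_of_mem_compIn h1.some_mem.2
  have hz := mem_of_mem_compIn h2.some_mem.2
  have hz2 : z ∈ G.lower f x \ (G.lower f y ∪ G.lower f y') :=
    ⟨hz.1, fun h => h.elim hz.2 hz'.2⟩
  obtain ⟨r', hr', t', ht', hadj'⟩ := exists_adj_compIn hz2 h2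
  obtain ⟨r, hr, t, ht, hadj⟩ := exists_adj_compIn (by rwa [Set.union_comm] at hz2) h1
  rw [Set.union_comm] at hr
  have hsub : ∀ a ∈ G.compIn (G.lower f x \ (G.lower f y ∪ G.lower f y')) z,
    a ∈ G.lower f x \ (G.lower f y ∪ G.lower f y') := fun a ha => compIn_subset ha
  refine ⟨fun b => cond b y y', fun b => cond b t t', _, compIn_isConn, mem_compIn_self hz2,
    fun a ha => (hsub a ha).1, ?_, hd, ?_, ?_, ?_⟩
  · rintro (_ | _) <;> assumption
  · rintro (_ | _) <;> refine Set.disjoint_left.2 fun a ha h => (hsub a ha).2 ?_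
    exacts [Or.inr h, Or.inl h]
  · rintro (_ | _) <;> assumption
  · rintro (_ | _)
    exacts [⟨ht', r', hr', hadj'⟩, ⟨ht, r, hr, hadj⟩]

/-- On a route from `z` within the connected set `G.lower f x`, whichever of the two sets is met
first is reached without touching the other. -/
theorem inter_compIn_nonempty {y y' : V} (hz : z ∈ G.lower f x) (hy : G.lower f y ⊆ G.lower f x)
    (hd : Disjoint (G.lower f y) (G.lower f y')) :
    (G.lower f y ∩ G.compIn (G.lower f x \ G.lower f y') z).Nonempty ∨
      (G.lower f y' ∩ G.compIn (G.lower f x \ G.lower f y) z).Nonempty := by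
  rw [Set.disjoint_left] at hd
  by_cases h1 : z ∈ G.lower f y
  · exact Or.inl ⟨z, h1, mem_compIn_self ⟨hz, hd h1⟩⟩
  by_cases h2 : z ∈ G.lower f y'
  · exact Or.inr ⟨z, h2, mem_compIn_self ⟨hz, h1⟩⟩
  by_contra! hcon
  have hne : ¬ G.lower f x ⊆ G.compIn (G.lower f x \ (G.lower f y ∪ G.lower f y')) z :=
    fun h => (compIn_subset (h (hy mem_lower_self))).2 (Or.inl mem_lower_self)
  refine hne (lower_isConn _ ⟨z, hz, mem_compIn_self ⟨hz, fun h => h.elim h1 h2⟩⟩ ?_)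
  intro a _ ha b hb hadj
  refine compIn_closed ha hadj ⟨hb, ?_⟩
  rintro (h | h)
  · refine Set.notMem_empty b (hcon.1 ▸ ⟨h, compIn_closed (compIn_mono ?_ ha) hadj ⟨hb, hd h⟩⟩)
    exact Set.sdiff_subset_sdiff_right Set.subset_union_right
  · refine Set.notMem_empty b (hcon.2 ▸ ⟨h, compIn_closed (compIn_mono ?_ ha) hadj
      ⟨hb, fun h' => hd h' h⟩⟩)
    exact Set.sdiff_subset_sdiff_right Set.subset_union_left

end Branching

/-! ### Small layouts in the absence of branching. -/

section Layout

variable {V : Type*} [Finite V] {G : SimpleGraph V} {f : V → ℕ} {Z : Set V} {s k κ τ : ℕ}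
  {x z : V}

/-- For `u` of largest rank in `Z`, no edge joins `Z ∩ G.lower f u` to the rest of `Z`, so this part
can be swept first at no lasting cost. -/
theorem hasLayout_of_lower (h : ∀ u ∈ Z, G.HasLayout (G.lower f u) s) : G.HasLayout Z s := by
  induction hn : Z.ncard using Nat.strong_induction_on generalizing Z with
  | _ n ih =>
  rcases Z.eq_empty_or_nonempty with rfl | hne
  · exact Sweep.empty
  obtain ⟨u, hu, hmax⟩ := Set.exists_max_image Z f (Set.toFinite Z) hne
  have hP : G.frontierIn Z (Z ∩ G.lower f u) = ∅ := by
    refine Set.eq_empty_of_forall_notMem ?_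
    rintro v ⟨hv, t, ht, htv, hadj⟩
    exact htv ⟨ht, lower_closed hv.2 hadj (hmax t ht)⟩
  have hfe : ∀ A : Set V, G.frontierIn A ∅ ⊆ ∅ := fun A v hv => hv.1
  have h1 : G.Sweep Z s (Z ∩ G.lower f u) := by
    refine Sweep.empty.extend (Y := ∅) (Set.empty_subset _) Set.inter_subset_left (hfe _)
      hP.subset (k := s) (by simp) ((h u hu).subset ?_)
    exact Set.sdiff_subset.trans (Set.sdiff_subset.trans Set.inter_subset_right)
  refine h1.extend (Y := ∅) Set.inter_subset_left subset_rfl hP.subset ?_ (k := s) (by simp) ?_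
  · rintro v ⟨hv, t, ht, htv, hadj⟩
    exact absurd ht htv
  · refine ih _ (hn ▸ Set.ncard_lt_ncard ?_ (Set.toFinite _)) (fun v hv => h v hv.1.1) rfl
    · rw [Set.ssubset_iff_of_subset (Set.sdiff_subset.trans Set.sdiff_subset)]
      exact ⟨u, hu, fun h => h.1.2 ⟨hu, mem_lower_self⟩⟩

/-- A set whose parts avoiding a chain of sets `lower` have small layouts has a small layout. -/
theorem hasLayout_of_chain (hf : f.Injective) (hτ : ∀ x, (G.attach f x).ncard < τ) (w : V)
    (h : ∀ Z' ⊆ Z, (∀ v ∈ Z', w ∉ G.lower f v) → G.HasLayout Z' k) :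
    G.HasLayout Z (k + 2 * τ) := by
  have hfr : ∀ u, G.frontierIn Z (Z ∩ (G.lower f u ∪ G.attach f u)) ⊆ G.attach f u := by
    rintro u v ⟨hv, t, ht, htv, hadj⟩
    rcases hv.2 with hv | hv
    · refine absurd ⟨ht, ?_⟩ htv
      by_cases h : t ∈ G.lower f u
      · exact Or.inl h
      · exact Or.inr ⟨h, v, hv, hadj⟩
    · exact hv
  have hmono : ∀ u v, w ∈ G.lower f u → w ∈ G.lower f v → f u ≤ f v →
      G.lower f u ⊆ G.lower f v := fun u v hu hv => mem_lower_of_mem_of_mem hu hv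
  have key : ∀ n u, f u = n → w ∈ G.lower f u →
      G.Sweep Z (k + 2 * τ) (Z ∩ (G.lower f u ∪ G.attach f u)) := by
    intro n
    induction n using Nat.strong_induction_on with
    | _ n ih =>
    intro u hu hwu
    have hins := Set.ncard_insert_le u (G.attach f u)
    have hu1 := hτ u
    by_cases hex : ∃ u', w ∈ G.lower f u' ∧ f u' < f u
    · obtain ⟨u', ⟨hwu', hlt⟩, hmax⟩ := Set.exists_max_image {u' | w ∈ G.lower f u' ∧ f u' < f u} f
        (Set.toFinite _) hex
      have hu2 := hτ u'
      have hs := hmono u' u hwu' hwu hlt.le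
      -- Here `u'` is the predecessor of `u` in the chain of sets `lower` containing `w`. Once `u`
      -- is put into `Y`, no remaining vertex has `w` in its set; `Y` has at most `(τ - 1) + 1 + (τ
      -- - 1)` elements.
      refine (ih _ (hu ▸ hlt) u' rfl hwu').extend (k := k)
        (Y := G.attach f u' ∪ insert u (G.attach f u)) ?_ Set.inter_subset_left ?_ ?_ ?_ ?_
      · refine Set.inter_subset_inter_right _ (Set.union_subset ?_ (attach_subset hs))
        exact hs.trans Set.subset_union_left
      · exact (hfr u').trans Set.subset_union_left
      · exact (hfr u).trans ((Set.subset_insert _ _).trans Set.subset_union_right)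
      · have := Set.ncard_union_le (G.attach f u') (insert u (G.attach f u))
        omega
      · refine h _ (fun v hv => hv.1.1.1) ?_
        rintro v ⟨⟨⟨hvZ, hv⟩, hv'⟩, hvY⟩ hwv
        simp only [Set.mem_union, Set.mem_insert_iff, not_or] at hvY
        have hvu : v ∈ G.lower f u := hv.resolve_right hvY.2.2
        by_cases hle : f v ≤ f u'
        · exact hv' ⟨hvZ, Or.inl (hmono v u' hwv hwu' hle mem_lower_self)⟩
        · have : ¬ f v < f u := fun hvu' => hle (hmax v ⟨hwv, hvu'⟩)
          have := rank_le_of_mem_lower hvu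
          exact hvY.2.1 (hf (by omega))
    · refine Sweep.empty.extend (k := k) (Y := insert u (G.attach f u)) (Set.empty_subset _)
        Set.inter_subset_left (fun v hv => absurd hv.1 id)
        ((hfr u).trans (Set.subset_insert _ _)) (by omega) ?_
      refine h _ (fun v hv => hv.1.1.1) ?_
      rintro v ⟨⟨⟨hvZ, hv⟩, -⟩, hvY⟩ hwv
      simp only [Set.mem_insert_iff, not_or] at hvY
      have hvu : v ∈ G.lower f u := hv.resolve_right hvY.2
      refine hex ⟨v, hwv, lt_of_le_of_ne (rank_le_of_mem_lower hvu) fun h => hvY.1 (hf h)⟩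
  obtain ⟨u, hwu, hmax⟩ := Set.exists_max_image {u | w ∈ G.lower f u} f (Set.toFinite _)
    ⟨w, mem_lower_self⟩
  refine (key _ u rfl hwu).extend (k := k) (Y := G.attach f u) Set.inter_subset_left subset_rfl
    (hfr u) (fun v ⟨hv, t, ht, htv, _⟩ => absurd ht htv) (by have := hτ u; omega) ?_
  refine h _ (fun v hv => hv.1.1) ?_
  rintro v ⟨⟨hvZ, hv⟩, -⟩ hwv
  exact hv ⟨hvZ, Or.inl (hmono v u hwv hwu (hmax v hwv) mem_lower_self)⟩

/-- Minimal heavy sets are linearly ordered by which separates which from `z`. Sweeping the sets `K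
m` in this order leaves only light pieces between consecutive ones, up to two chains. -/
theorem hasLayout_lower_of_not_hasBranching (hf : f.Injective)
    (hτ : ∀ x, (G.attach f x).ncard < τ) (hz : z ∈ G.lower f x)
    (hno : ¬ G.HasBranching f s x z) : G.HasLayout (G.lower f x) (s + 6 * τ) := by
  set S := G.lower f x with hS
  set K : V → Set V := fun w => G.compIn (S \ G.lower f w) z with hK
  set M : Set V := {m | m ∈ S ∧ ¬ G.HasLayout (G.lower f m) s ∧
    ∀ u ∈ G.lower f m, ¬ G.HasLayout (G.lower f u) s → u = m} with hM
  have hSM : ∀ m ∈ M, G.lower f m ⊆ S := fun m hm => lower_subset_of_mem hm.1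
  have hexM : ∀ u ∈ S, ¬ G.HasLayout (G.lower f u) s → ∃ m ∈ M, m ∈ G.lower f u := by
    intro u hu hh
    obtain ⟨m, hm, hmin⟩ := Set.exists_min_image
      {m | m ∈ G.lower f u ∧ ¬ G.HasLayout (G.lower f m) s} f (Set.toFinite _)
      ⟨u, mem_lower_self, hh⟩
    refine ⟨m, ⟨lower_subset_of_mem hu hm.1, hm.2, fun v hv hvh => hf (le_antisymm
      (rank_le_of_mem_lower hv) (hmin v ⟨lower_subset_of_mem hm.1 hv, hvh⟩))⟩, hm.1⟩
  have hdM : ∀ m ∈ M, ∀ m' ∈ M, m ≠ m' → Disjoint (G.lower f m) (G.lower f m') := by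
    intro m hm m' hm' hne
    exact lower_disjoint (fun h => hne (hm'.2.2 m h hm.2.1)) fun h => hne (hm.2.2 m' h hm'.2.1).symm
  have hfrK : ∀ w, G.frontierIn S (K w) ⊆ G.attach f w := by
    rintro w v ⟨hv, t, ht, htv, hadj⟩
    have htw : t ∈ G.lower f w := by
      by_contra h
      exact htv (compIn_closed hv hadj ⟨ht, h⟩)
    exact ⟨(compIn_subset hv).2, t, htw, hadj.symm⟩
  have hKS : ∀ w, K w ⊆ S := fun w v hv => (compIn_subset hv).1
  have hKd : ∀ w v, v ∈ K w → v ∉ G.lower f w := fun w v hv => (compIn_subset hv).2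
  have hzK : ∀ w v, v ∈ K w → z ∈ K w := fun w v hv => mem_compIn_self (mem_of_mem_compIn hv)
  -- a set `lower` disjoint from `lower w` and meeting `K w` lies in `K w`
  have habs : ∀ w u, u ∈ S → Disjoint (G.lower f u) (G.lower f w) →
      (G.lower f u ∩ K w).Nonempty → G.lower f u ⊆ K w := by
    rintro w u hu hd ⟨a, ha, haK⟩
    exact lower_isConn.subset_compIn (fun b hb => ⟨lower_subset_of_mem hu hb,
      Set.disjoint_left.1 hd hb⟩) ha haK
  -- If `lower m'` also met `K m`, there would be a branching. So `K m` avoids `lower m'` and is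
  -- contained in `K m'`.
  have hbefore : ∀ m ∈ M, ∀ m' ∈ M, m ≠ m' → G.lower f m ⊆ K m' → K m ⊂ K m' := by
    intro m hm m' hm' hne hsub
    have hempty : ¬ (G.lower f m' ∩ K m).Nonempty := fun h =>
      hno (hasBranching_of_nonempty (hSM m hm) (hSM m' hm') (hdM m hm m' hm' hne) hm.2.1 hm'.2.1
        ⟨m, mem_lower_self, hsub mem_lower_self⟩ h)
    refine (Set.ssubset_iff_of_subset fun v hv => ?_).2
      ⟨m, hsub mem_lower_self, fun h => hKd m m h mem_lower_self⟩
    exact (compIn_isConn : G.IsConn (K m)).subset_compIn (B := S \ G.lower f m') (fun u hu => ⟨hKS m hu, fun h => hempty ⟨u, h, hu⟩⟩)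
      (hzK m v hv) (hzK m' m (hsub mem_lower_self)) hv
  -- Continue from the largest `K w'` with `lower w'` in `P'`. The budget `6τ` is `2τ` for `attach
  -- w'` and `A`, and `2τ` for each of the chains through `w` and `w'`. A heavy set left over would
  -- lie in `K w'` or contain some `m` with larger `K m`.
  have main : ∀ (w : V) (P' A : Set V), P' ⊆ S → G.frontierIn S P' ⊆ A → A.ncard ≤ τ →
      (∀ u ∈ P', ¬ G.HasLayout (G.lower f u) s → w ∈ G.lower f u ∨ G.lower f u ⊆ P') →
      (∀ m ∈ M, G.lower f m ⊆ P' → K m ⊂ P' ∧ G.Sweep S (s + 6 * τ) (K m)) →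
      G.Sweep S (s + 6 * τ) P' := by
    intro w P' A hP' hA hAτ hheavy hIH
    by_cases hex : ∃ m ∈ M, G.lower f m ⊆ P'
    · obtain ⟨w', ⟨hw'M, hw'P⟩, hmax⟩ := Set.exists_max_image
        {m | m ∈ M ∧ G.lower f m ⊆ P'} (fun m => (K m).ncard) (Set.toFinite _) hex
      obtain ⟨hss, hsw⟩ := hIH w' hw'M hw'P
      refine hsw.extend (k := s + 2 * τ + 2 * τ) (Y := G.attach f w' ∪ A) hss.subset hP'
        ((hfrK w').trans Set.subset_union_left) (hA.trans Set.subset_union_right) ?_ ?_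
      · have := Set.ncard_union_le (G.attach f w') A
        have := hτ w'
        omega
      refine hasLayout_of_chain hf hτ w fun Z hZ hZw => hasLayout_of_chain hf hτ w'
        fun Z' hZ' hZw' => hasLayout_of_lower (f := f) fun u hu => ?_
      by_contra hh
      obtain ⟨⟨huP, huK⟩, -⟩ := hZ (hZ' hu)
      have hsubu := (hheavy u huP hh).resolve_left (hZw u (hZ' hu))
      obtain ⟨m, hmM, hmu⟩ := hexM u (hP' huP) hh
      have hmu' := lower_subset_of_mem hmu
      have hmw' : m ≠ w' := fun h => hZw' u hu (h ▸ hmu)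
      have hle := hmax m ⟨hmM, hmu'.trans hsubu⟩
      have hduw' : Disjoint (G.lower f u) (G.lower f w') := by
        refine lower_disjoint (fun h => ?_) (hZw' u hu)
        exact hZw' u hu (hw'M.2.2 u h hh ▸ mem_lower_self)
      rcases inter_compIn_nonempty hz (hSM m hmM) (hdM m hmM w' hw'M hmw') with h | h
      · refine huK (habs w' u (hP' huP) hduw' ?_ mem_lower_self)
        exact h.mono (Set.inter_subset_inter_left _ hmu')
      · have := habs m w' hw'M.1 (hdM w' hw'M m hmM hmw'.symm) h
        have := Set.ncard_lt_ncard (hbefore w' hw'M m hmM hmw'.symm this) (Set.toFinite _)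
        exact absurd hle (not_le.2 this)
    · refine Sweep.empty.extend (k := s + 2 * τ) (Y := A) (Set.empty_subset _) hP'
        (fun v hv => absurd hv.1 id) hA (by omega) ?_
      refine hasLayout_of_chain hf hτ w fun Z hZ hZw => hasLayout_of_lower (f := f) fun u hu => ?_
      by_contra hh
      have huP := (hZ hu).1.1
      have hsubu := (hheavy u huP hh).resolve_left (hZw u hu)
      obtain ⟨m, hmM, hmu⟩ := hexM u (hP' huP) hh
      exact hex ⟨m, hmM, (lower_subset_of_mem hmu).trans hsubu⟩
  have hsweepK : ∀ n, ∀ w ∈ M, (K w).ncard = n → G.Sweep S (s + 6 * τ) (K w) := by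
    intro n
    induction n using Nat.strong_induction_on with
    | _ n ih =>
    intro w hw hn
    refine main w (K w) (G.attach f w) (hKS w) (hfrK w) (hτ w).le ?_ ?_
    · intro u hu hh
      by_cases hwu : w ∈ G.lower f u
      · exact Or.inl hwu
      · exact Or.inr (habs w u (hKS w hu) (lower_disjoint (hKd w u hu) hwu)
          ⟨u, mem_lower_self, hu⟩)
    · intro m hm hsub
      have hne : m ≠ w := by
        rintro rfl
        exact hKd m m (hsub mem_lower_self) mem_lower_self
      have hss := hbefore m hm w hw hne hsub
      exact ⟨hss, ih _ (hn ▸ Set.ncard_lt_ncard hss (Set.toFinite _)) m hm rfl⟩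
  -- The chain vertex `z` is arbitrary here: every set `lower` of a vertex of `S` lies in `S`.
  refine main z S ∅ subset_rfl (fun v ⟨_, t, ht, htv, _⟩ => absurd ht htv) (by simp)
    (fun u hu _ => Or.inr (lower_subset_of_mem hu)) fun m hm hsub => ⟨?_, hsweepK _ m hm rfl⟩
  exact (Set.ssubset_iff_of_subset (hKS m)).2 ⟨m, hm.1, fun h => hKd m m h mem_lower_self⟩

end Layout
-- Elimination orders from tree decompositions.
theorem isConn_of_induce_connected {V : Type*} {G : SimpleGraph V} {C : Set V}
    (h : (G.induce C).Connected) : G.IsConn C := by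
  rintro D ⟨a, ha, haD⟩ hD b hb
  obtain hr := (reachable_iff_reflTransGen _ _).1 (h.preconnected ⟨a, ha⟩ ⟨b, hb⟩)
  have key : ∀ c : C, Relation.ReflTransGen (G.induce C).Adj ⟨a, ha⟩ c → c.1 ∈ D := by
    intro c hc
    induction hc with
    | refl => exact haD
    | @tail u v _ huv ih => exact hD u u.2 ih v v.2 (by simpa using huv)
  exact key _ hr

section Rank

variable {ι : Type*} {T : SimpleGraph ι} {r a b s t : ι}

theorem IsTree.eq_of_dist_add_one (hT : T.IsTree) (ha : T.Adj a s) (hb : T.Adj b s)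
    (hda : T.dist r s = T.dist r a + 1) (hdb : T.dist r s = T.dist r b + 1) : a = b := by
  obtain ⟨p, _, hpl⟩ := hT.connected.exists_path_of_dist r a
  obtain ⟨q, _, hql⟩ := hT.connected.exists_path_of_dist r b
  have hp := (p.concat ha).isPath_of_length_eq_dist (by simp [hpl, hda])
  have hq := (q.concat hb).isPath_of_length_eq_dist (by simp [hql, hdb])
  have := (hT.existsUnique_path r s).unique hp hq
  simpa using congrArg Walk.penultimate this

/-- In a rooted tree, a component of the nodes of depth at least `d` has at most one node of
depth `d`. -/
theorem IsTree.eq_of_mem_compIn (hT : T.IsTree)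
    (hs : s ∈ T.compIn {a | T.dist r t ≤ T.dist r a} t) (hd : T.dist r s = T.dist r t) :
    s = t := by
  -- Parents are unique, so a step up only retraces the last step down: the whole component is
  -- reached by descending from `t`.
  have key : T.compIn {a | T.dist r t ≤ T.dist r a} t ⊆
      {a | Relation.ReflTransGen (fun a b => T.Adj a b ∧ T.dist r b = T.dist r a + 1) t a} := by
    refine compIn_subset_of_closed .refl fun a _ ha b hb hadj => ?_
    rcases hT.dist_eq_dist_add_one_of_adj r hadj with h | h
    · rcases Relation.ReflTransGen.cases_tail ha with rfl | ⟨c, hc, hca, hcd⟩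
      · have : T.dist r a ≤ T.dist r b := hb
        omega
      · rwa [hT.eq_of_dist_add_one hadj.symm hca h hcd]
    · exact Relation.ReflTransGen.tail ha ⟨hadj, h⟩
  rcases Relation.ReflTransGen.cases_tail (key hs) with h | ⟨c, hc, hcs, hcd⟩
  · exact h
  · have : T.dist r t ≤ T.dist r c := by
      clear hcd hcs hs hd
      induction hc with
      | refl => exact le_rfl
      | tail _ h ih => exact ih.trans (by rw [h.2]; omega)
    omega

/-- Rank lexicographically by reversed depth and then by an enumeration `e`; since `e v < k`, ties
cannot override depth. -/
theorem exists_injective_of_depth {V : Type*} [Finite V] (d : V → ℕ) :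
    ∃ f : V → ℕ, f.Injective ∧ ∀ u v, f u ≤ f v → d v ≤ d u := by
  obtain ⟨k, ⟨e⟩⟩ := Finite.exists_equiv_fin V
  obtain ⟨B, hB⟩ := (Set.finite_range d).bddAbove
  have hB' : ∀ v, d v ≤ B := fun v => hB ⟨v, rfl⟩
  have key : ∀ u v, (B - d u) * k + e u ≤ (B - d v) * k + e v → d v ≤ d u := by
    intro u v h
    by_contra! hlt
    have h1 : B - d v + 1 ≤ B - d u := by have := hB' v; omega
    have h2 := Nat.mul_le_mul_right k h1
    have h3 := (e v).2
    rw [add_mul] at h2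
    omega
  refine ⟨fun v => (B - d v) * k + e v, fun u v h => ?_, key⟩
  have h1 := le_antisymm (key v u (le_of_eq h.symm)) (key u v (le_of_eq h))
  simp only [h1, Nat.add_left_cancel_iff] at h
  exact e.injective (Fin.ext h)

/-- A graph with a tree decomposition into bags of size at most `τ` has an elimination order. -/
theorem IsTreeDecomposition.exists_rank {V : Type*} [Finite V] {G : SimpleGraph V}
    {β : ι → Finset V} {τ : ℕ} (h : G.IsTreeDecomposition T β) (hτ : ∀ x, (β x).card ≤ τ) :
    ∃ f : V → ℕ, f.Injective ∧ ∀ x, (G.attach f x).ncard < τ := by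
  have hT := h.isTree
  obtain ⟨r⟩ := hT.connected.nonempty
  have hC : ∀ v, T.IsConn {x | v ∈ β x} := fun v => isConn_of_induce_connected (h.connected v)
  have htop : ∀ v, ∃ t, v ∈ β t ∧ ∀ s, v ∈ β s → T.dist r t ≤ T.dist r s := by
    intro v
    obtain ⟨⟨x, hx⟩⟩ := (h.connected v).nonempty
    have hex : ∃ n t, v ∈ β t ∧ T.dist r t = n := ⟨_, x, hx, rfl⟩
    classical
    obtain ⟨t, ht, htn⟩ := Nat.find_spec hex
    exact ⟨t, ht, fun s hs => htn ▸ Nat.find_min' hex ⟨s, hs, rfl⟩⟩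
  choose top htop hmin using htop
  obtain ⟨f, hf, hfd⟩ := exists_injective_of_depth fun v => T.dist r (top v)
  refine ⟨f, hf, fun x => ?_⟩
  set B := T.compIn {a | T.dist r (top x) ≤ T.dist r a} (top x) with hB
  have h1 : G.lower f x ⊆ {y | {s | y ∈ β s} ⊆ B} := by
    refine compIn_subset_of_closed ?_ ?_
    · exact (hC x).subset_compIn (fun s hs => hmin x s hs) (htop x)
        (mem_compIn_self (le_refl (T.dist r (top x))))
    · intro a _ ha b hb hadj
      obtain ⟨s, hsa, hsb⟩ := h.exists_bag a b hadj
      exact (hC b).subset_compIn (fun s hs => (hfd b x hb).trans (hmin b s hs)) hsb (ha hsa)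
  have h2 : G.attach f x ⊆ (β (top x) : Set V) \ {x} := by
    rintro u ⟨hu, v, hv, hadj⟩
    refine ⟨?_, fun hux => hu (hux ▸ mem_lower_self)⟩
    have hlt : f x < f u := by
      by_contra! hle
      exact hu (lower_closed hv hadj hle)
    obtain ⟨s, hsv, hsu⟩ := h.exists_bag v u hadj
    by_contra hut
    -- The nodes of `u` could leave `B` only through its unique shallowest node `top x`, whose bag
    -- omits `u`.
    have hsub : {s | u ∈ β s} ⊆ B := by
      refine hC u _ ⟨s, hsu, h1 hv hsv⟩ fun a ha haB b hb hab => ?_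
      have haD : T.dist r (top x) ≤ T.dist r a :=
        (compIn_subset haB : a ∈ {a | T.dist r (top x) ≤ T.dist r a})
      refine compIn_closed haB hab ?_
      by_contra hbD
      simp only [Set.mem_ofPred_eq, not_le] at hbD
      have := hT.dist_eq_dist_add_one_of_adj r hab
      have : a = top x := hT.eq_of_mem_compIn haB (by omega)
      exact hut (this ▸ ha)
    have htu := hsub (htop u)
    have hle : T.dist r (top x) ≤ T.dist r (top u) :=
      (compIn_subset htu : top u ∈ {a | T.dist r (top x) ≤ T.dist r a})
    have := hT.eq_of_mem_compIn htu (le_antisymm (hfd x u hlt.le) hle)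
    exact hut (this ▸ htop u)
  have h3 := Set.ncard_le_ncard h2 (Set.toFinite _)
  rw [Set.ncard_sdiff_singleton_of_mem (htop x), Set.ncard_coe_finset] at h3
  have := hτ (top x)
  have : 0 < (β (top x)).card := Finset.card_pos.2 ⟨x, htop x⟩
  omega

end Rank

/-! ### Path decompositions from layouts. -/

theorem pathGraph_isTree (n : ℕ) : (pathGraph (n + 1)).IsTree := by
  refine ⟨pathGraph_connected n, isAcyclic_iff_forall_adj_isBridge.2 fun v w hadj => ?_⟩
  have key : ∀ v w : Fin (n + 1), v.val + 1 = w.val →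
      (pathGraph (n + 1)).IsBridge s(v, w) := by
    intro v w hvw hr
    rw [reachable_iff_reflTransGen] at hr
    have : ∀ x, Relation.ReflTransGen ((pathGraph (n + 1)).deleteEdges {s(v, w)}).Adj v x →
        x.val ≤ v.val := by
      intro x hx
      induction hx with
      | refl => exact le_rfl
      | @tail a b _ hab ih =>
        rw [deleteEdges_adj, pathGraph_adj] at hab
        by_contra hlt
        have h1 : a = v := Fin.ext (by omega)
        have h2 : b = w := Fin.ext (by omega)
        simp [h1, h2] at hab
    have := this w hr
    omega
  rcases pathGraph_adj.1 hadj with h | h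
  · exact key v w h
  · rw [Sym2.eq_swap]
    exact key w v h

theorem pathGraph_induce_connected {n l r : ℕ} (hlr : l ≤ r) (hr : r < n) :
    ((pathGraph n).induce {x | l ≤ x.val ∧ x.val ≤ r}).Connected := by
  have hmem : (⟨l, by omega⟩ : Fin n) ∈ {x : Fin n | l ≤ x.val ∧ x.val ≤ r} := ⟨le_rfl, hlr⟩
  rw [connected_iff_exists_forall_reachable]
  refine ⟨⟨_, hmem⟩, ?_⟩
  have key : ∀ (i : ℕ) (hi : l + i ≤ r), ((pathGraph n).induce
      {x | l ≤ x.val ∧ x.val ≤ r}).Reachable ⟨_, hmem⟩ ⟨⟨l + i, by omega⟩, by simpa using hi⟩ := by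
    intro i
    induction i with
    | zero => exact fun _ => Reachable.refl _
    | succ i ih =>
      intro hi
      refine (ih (by omega)).trans (Adj.reachable ?_)
      simp [pathGraph_adj]
      omega
  rintro ⟨x, hx⟩
  obtain ⟨i, hi⟩ := Nat.exists_eq_add_of_le (hx.1 : l ≤ x.val)
  have := key i (hi ▸ hx.2)
  simpa only [← hi] using this

/-- Bag `i` consists of the `i`-th new vertex and the frontier just before its insertion, hence `k +
1`. The invariant `r v + 1 = n` says that the current frontier lies in the last bag. -/
theorem Sweep.exists_intervals {V : Type*} [Finite V] {G : SimpleGraph V} {k : ℕ} {W : Set V}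
    (h : G.Sweep Set.univ k W) : (G.frontierIn Set.univ W).ncard ≤ k ∧
    ∃ (n : ℕ) (l r : V → ℕ), (∀ v ∈ W, l v ≤ r v ∧ r v < n) ∧
      (∀ v ∈ G.frontierIn Set.univ W, r v + 1 = n) ∧
      (∀ u ∈ W, ∀ v ∈ W, G.Adj u v → l u ≤ r v) ∧
      ∀ i, {v | v ∈ W ∧ l v ≤ i ∧ i ≤ r v}.ncard ≤ k + 1 := by
  classical
  induction h with
  | empty =>
    have : G.frontierIn Set.univ ∅ = ∅ := Set.eq_empty_of_forall_notMem fun v hv => hv.1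
    simp [this]
  | @insert W a _ _ hk ih =>
    refine ⟨hk, ?_⟩
    by_cases ha : a ∈ W
    · rw [Set.insert_eq_of_mem ha]
      exact ih.2
    obtain ⟨hk', n, l, r, h1, h2, h3, h4⟩ := ih
    have hW : ∀ v ∈ W, v ≠ a := fun v hv h => ha (h ▸ hv)
    refine ⟨n + 1, fun v => if v = a then n else l v,
      fun v => if v = a ∨ v ∈ G.frontierIn Set.univ W then n else r v, ?_, ?_, ?_, ?_⟩
    · rintro v (rfl | hv)
      · simp
      · have := h1 v hv
        simp only [hW v hv, if_false, false_or]
        split_ifs <;> omega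
    · rintro v ⟨rfl | hv, u, _, hu, hadj⟩
      · simp
      · have : v ∈ G.frontierIn Set.univ W :=
          ⟨hv, u, Set.mem_univ _, fun h => hu (Or.inr h), hadj⟩
        simp [this]
    · rintro u (rfl | hu) v (rfl | hv) hadj
      · simp
      · have : v ∈ G.frontierIn Set.univ W := ⟨hv, u, Set.mem_univ _, ha, hadj.symm⟩
        simp [this]
      · have := h1 u hu
        simp only [hW u hu, if_false, true_or, if_true]
        omega
      · have := h1 u hu
        have := h3 u hu v hv hadj
        simp only [hW u hu, hW v hv, if_false, false_or]
        split_ifs <;> omega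
    · intro i
      rcases lt_or_ge i n with hi | hi
      · refine (Set.ncard_le_ncard ?_ (Set.toFinite _)).trans (h4 i)
        rintro v ⟨rfl | hv, h5, h6⟩
        · simp at h5
          omega
        · simp only [hW v hv, if_false, false_or] at h5 h6
          refine ⟨hv, h5, ?_⟩
          split_ifs at h6 with h
          · have := h2 v h
            omega
          · exact h6
      · refine (Set.ncard_le_ncard (t := Insert.insert a (G.frontierIn Set.univ W)) ?_
          (Set.toFinite _)).trans ((Set.ncard_insert_le _ _).trans (by omega))
        rintro v ⟨rfl | hv, _, h6⟩
        · exact Or.inl rfl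
        · simp only [hW v hv, false_or] at h6
          have := h1 v hv
          split_ifs at h6 with h
          · exact Or.inr h
          · omega

theorem HasLayout.hasPathwidthAtMost {V : Type*} [Finite V] {G : SimpleGraph V} {k : ℕ}
    (h : G.HasLayout Set.univ k) : G.HasPathwidthAtMost k := by
  classical
  have := Fintype.ofFinite V
  obtain ⟨-, n, l, r, h1, -, h3, h4⟩ := Sweep.exists_intervals h
  refine ⟨n + 1, pathGraph (n + 1),
    fun i => Finset.univ.filter fun v => l v ≤ i.val ∧ i.val ≤ r v,
    ⟨⟨pathGraph_isTree n, fun v => ?_, fun u v hadj => ?_⟩, n + 1, ⟨Iso.refl⟩⟩, fun i => ?_⟩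
  · have := h1 v (Set.mem_univ v)
    have hset : {x : Fin (n + 1) | v ∈ Finset.univ.filter fun v => l v ≤ x.val ∧ x.val ≤ r v} =
        {x | l v ≤ x.val ∧ x.val ≤ r v} := by
      ext x
      simp
    rw [hset]
    exact pathGraph_induce_connected this.1 (by omega)
  · have := h1 u (Set.mem_univ u)
    have := h1 v (Set.mem_univ v)
    have := h3 u (Set.mem_univ u) v (Set.mem_univ v) hadj
    have := h3 v (Set.mem_univ v) u (Set.mem_univ u) hadj.symm
    refine ⟨⟨max (l u) (l v), by omega⟩, ?_, ?_⟩ <;> simp <;> omega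
  · have := h4 i
    rw [← Set.ncard_coe_finset]
    simpa using this

end SimpleGraph

/-! ### Selecting levels of the binary tree. -/

section Words

theorem exists_cons_suffix {α : Type*} {u v : List α} (h : u <:+ v) (hne : u ≠ v) :
    ∃ b, b :: u <:+ v := by
  obtain ⟨t, rfl⟩ := h
  rcases List.eq_nil_or_concat t with rfl | ⟨t', b, rfl⟩
  · simp at hne
  · exact ⟨b, t', by simp⟩

theorem exists_cons_suffix_of_not_suffix {u v : List Bool} (h : ¬ u <:+ v) (h' : ¬ v <:+ u) :
    ∃ (w : List Bool) (b : Bool), b :: w <:+ u ∧ (!b) :: w <:+ v := by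
  induction u with
  | nil => exact absurd (List.nil_suffix) h
  | cons a u ih =>
    by_cases hu : u <:+ v
    · have hne : u ≠ v := by
        rintro rfl
        exact h' (List.suffix_cons _ _)
      obtain ⟨c, hc⟩ := exists_cons_suffix hu hne
      refine ⟨u, a, List.suffix_rfl, ?_⟩
      have hca : c ≠ a := by
        rintro rfl
        exact h hc
      rwa [← Bool.eq_not_of_ne hca]
    · obtain ⟨w, b, hw, hw'⟩ := ih hu fun h => h' (h.trans (List.suffix_cons _ _))
      exact ⟨w, b, hw.trans (List.suffix_cons _ _), hw'⟩

theorem exists_suffix_length_eq {p : List Bool} {n : ℕ} (h : p.length ≤ n) :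
    ∃ w, p <:+ w ∧ w.length = n :=
  ⟨List.replicate (n - p.length) true ++ p, List.suffix_append _ _, by simp; omega⟩

/-- If every word sees fewer than `M` words, then among `M * n` consecutive levels there is a
block of `n` levels, all of whose exits extend to words that see nothing in the block. -/
theorem exists_unseen_block (sees : List Bool → List Bool → Prop) {M n L : ℕ} (p : List Bool)
    (hL : L = p.length + M * n)
    (hfew : ∀ v, v.length = L → {u | sees u v}.Finite ∧ {u | sees u v}.ncard < M) :
    ∃ q, p <:+ q ∧ q.length + n ≤ L ∧ ∀ w, q <:+ w → w.length = q.length + n →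
      ∃ v, w <:+ v ∧ v.length = L ∧
        ∀ u, q <:+ u → u.length < q.length + n → ¬ sees u v := by
  by_contra! hcon
  -- Each failing block has an exit all of whose extensions to level `L` see a word of the block.
  -- Stacking `i` such blocks forces `i` seen words; `i = M` is too many.
  have key : ∀ i ≤ M, ∃ q, p <:+ q ∧ q.length = p.length + i * n ∧ ∀ v, q <:+ v → v.length = L →
      i ≤ {u | sees u v ∧ u.length < q.length}.ncard := by
    intro i
    induction i with
    | zero => exact fun _ => ⟨p, List.suffix_rfl, by simp, fun _ _ _ => Nat.zero_le _⟩
    | succ i ih =>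
      intro hi
      obtain ⟨q, hpq, hq, hv⟩ := ih (by omega)
      have hle : (i + 1) * n ≤ M * n := Nat.mul_le_mul_right n hi
      rw [add_mul, one_mul] at hle
      obtain ⟨w, hqw, hw, hsee⟩ := hcon q hpq (by omega)
      refine ⟨w, hpq.trans hqw, by rw [hw, hq, add_mul, one_mul, add_assoc], fun v hwv hvL => ?_⟩
      obtain ⟨u, hqu, hu, huv⟩ := hsee v hwv hvL
      have h1 := hv v (hqw.trans hwv) hvL
      have hfin : {u | sees u v ∧ u.length < w.length}.Finite :=
        (hfew v hvL).1.subset fun _ h => h.1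
      refine lt_of_le_of_lt h1 (Set.ncard_lt_ncard ?_ hfin)
      have hsub : {u | sees u v ∧ u.length < q.length} ⊆ {u | sees u v ∧ u.length < w.length} :=
        fun t ht => ⟨ht.1, ht.2.trans_le hqw.length_le⟩
      refine (Set.ssubset_iff_of_subset hsub).2
        ⟨u, ⟨huv, by omega⟩, fun h => ?_⟩
      have := h.2
      have := hqu.length_le
      omega
  obtain ⟨q, -, hq, hv⟩ := key M le_rfl
  have h1 := hv q List.suffix_rfl (by omega)
  have h2 := hfew q (by omega)
  exact absurd (h1.trans (Set.ncard_le_ncard (fun _ h => h.1) h2.1)) (not_le.2 h2.2)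

/-- The words between the child of `ℓ σ'` and `ℓ σ`, where `σ'` is the parent of `σ`. -/
def wordSegment (ℓ : List Bool → List Bool) : List Bool → Set (List Bool)
  | [] => {ℓ []}
  | i :: σ => {u | i :: ℓ σ <:+ u ∧ u <:+ ℓ (i :: σ)}

/-- The number of levels used to embed `k + 1` levels with segments that do not see each other. -/
def levels (M : ℕ) : ℕ → ℕ
  | 0 => 1
  | k + 1 => M * levels M k + 1

/-- The first `k + 1` levels go inside an unseen block; the last level is pushed down to words that
see nothing in that block. That level is the `+ 1` in `levels`. -/
theorem exists_unseen_segments (sees : List Bool → List Bool → Prop) {M N : ℕ}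
    (hfew : ∀ v, v.length < N → {u | sees u v}.Finite ∧ {u | sees u v}.ncard < M) (k : ℕ)
    (p : List Bool) (hp : p.length + levels M k ≤ N) :
    ∃ ℓ : List Bool → List Bool,
      (∀ σ, σ.length ≤ k → p <:+ ℓ σ ∧ (ℓ σ).length < p.length + levels M k) ∧
      (∀ i σ, σ.length < k → i :: ℓ σ <:+ ℓ (i :: σ)) ∧
      ∀ τ, τ.length ≤ k → ∀ σ, σ <:+ τ → σ ≠ τ → ∀ u ∈ wordSegment ℓ σ, ¬ sees u (ℓ τ) := by
  induction k generalizing p with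
  | zero =>
    refine ⟨fun _ => p, fun _ _ => ⟨List.suffix_rfl, by simp [levels]⟩, by simp, ?_⟩
    intro τ hτ σ hσ hne
    have h1 := List.eq_nil_of_length_eq_zero (Nat.le_zero.1 hτ)
    subst h1
    exact absurd (List.suffix_nil.1 hσ) hne
  | succ k ih =>
    rw [levels] at hp
    set n := levels M k with hn
    obtain ⟨q, hpq, hqL, hq⟩ := exists_unseen_block sees (M := M) (n := n) p rfl
      fun v hv => hfew v (by omega)
    obtain ⟨ℓ, h1, h2, h3⟩ := ih q (by omega)
    have hext : ∀ x, q <:+ x → x.length ≤ q.length + n → ∃ v, x <:+ v ∧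
        v.length = p.length + M * n ∧ ∀ u, q <:+ u → u.length < q.length + n → ¬ sees u v := by
      intro x hx hxl
      obtain ⟨w, hxw, hw⟩ := exists_suffix_length_eq hxl
      obtain ⟨v, hwv, hv⟩ := hq w (hx.trans hxw) hw
      exact ⟨v, hxw.trans hwv, hv⟩
    choose! e he1 he2 he3 using hext
    set ℓ' : List Bool → List Bool := fun σ => if σ.length ≤ k then ℓ σ else
      e (σ.headI :: ℓ σ.tail) with hℓ'
    have hle : ∀ σ, σ.length ≤ k → ℓ' σ = ℓ σ := fun σ hσ => if_pos hσ
    have hgt : ∀ i σ, σ.length = k → ℓ' (i :: σ) = e (i :: ℓ σ) := fun i σ hσ => by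
      simp [hℓ', hσ]
    have hseg : ∀ σ, σ.length ≤ k → wordSegment ℓ' σ = wordSegment ℓ σ := by
      rintro (_ | ⟨i, σ⟩) hσ
      · simp only [wordSegment]
        rw [hle [] hσ]
      · have : σ.length ≤ k := by simp at hσ; omega
        simp only [wordSegment]
        rw [hle _ hσ, hle _ this]
    have hx : ∀ i σ, σ.length ≤ k → q <:+ i :: ℓ σ ∧ (i :: ℓ σ).length ≤ q.length + n := by
      intro i σ hσ
      have := (h1 σ hσ).2
      exact ⟨(h1 σ hσ).1.trans (List.suffix_cons _ _), by simp; omega⟩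
    refine ⟨ℓ', ?_, ?_, ?_⟩
    · intro σ hσ
      rw [levels, ← hn]
      rcases Nat.lt_or_ge k σ.length with hk | hk
      · obtain ⟨i, σ, rfl⟩ := List.exists_cons_of_length_pos (by omega : 0 < σ.length)
        have hσk : σ.length = k := by simp at hσ hk; omega
        obtain ⟨hx1, hx2⟩ := hx i σ hσk.le
        rw [hgt i σ hσk, he2 _ hx1 hx2]
        exact ⟨(hpq.trans hx1).trans (he1 _ hx1 hx2), by omega⟩
      · rw [hle σ hk]
        have := (h1 σ hk).2
        exact ⟨hpq.trans (h1 σ hk).1, by omega⟩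
    · intro i σ hσ
      rw [hle σ (by omega)]
      rcases Nat.lt_or_ge σ.length k with hk | hk
      · rw [hle (i :: σ) (by simp; omega)]
        exact h2 i σ hk
      · rw [hgt i σ (by omega)]
        obtain ⟨hx1, hx2⟩ := hx i σ (by omega)
        exact he1 _ hx1 hx2
    · intro τ hτ σ hσ hne u hu
      have hlt : σ.length < τ.length :=
        lt_of_le_of_ne hσ.length_le fun h => hne (hσ.eq_of_length h)
      rw [hseg σ (by omega)] at hu
      rcases Nat.lt_or_ge k τ.length with hk | hk
      · obtain ⟨i, τ, rfl⟩ := List.exists_cons_of_length_pos (by omega : 0 < τ.length)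
        have hτk : τ.length = k := by simp at hτ hk; omega
        obtain ⟨hx1, hx2⟩ := hx i τ hτk.le
        rw [hgt i τ hτk]
        have hσk : σ.length ≤ k := by omega
        have hlσ := (h1 σ hσk).2
        rcases σ with _ | ⟨j, σ⟩
        · simp only [wordSegment, Set.mem_singleton_iff] at hu
          subst hu
          exact he3 _ hx1 hx2 _ (h1 [] hσk).1 hlσ
        · have := (h1 σ (by simp at hσk; omega)).1
          exact he3 _ hx1 hx2 _ ((this.trans (List.suffix_cons _ _)).trans hu.1)
            (hu.2.length_le.trans_lt hlσ)
      · rw [hle τ hk]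
        exact h3 τ hk σ hσ hne u hu

/-- `levels M k` is the geometric sum `1 + M + ... + M^k`. -/
theorem levels_lt {M : ℕ} (hM : 2 ≤ M) (k : ℕ) : levels M k < M ^ (k + 1) := by
  induction k with
  | zero => simp only [levels, zero_add, pow_one]; omega
  | succ k ih =>
    rw [levels, pow_succ]
    have : M * (levels M k + 1) ≤ M * M ^ (k + 1) := Nat.mul_le_mul_left M ih
    rw [mul_add, mul_one] at this
    rw [mul_comm (M ^ (k + 1))]
    omega

end Words

/-! ### Induced binary trees in branch systems. -/

namespace SimpleGraph

/-- A family of connected sets `R w` indexed by the binary words of length less than `N`, together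
with sets `S w` containing the sets `R v` for all `v` extending `w`. -/
structure IsBranchSystem {V : Type*} (G : SimpleGraph V) (N τ : ℕ) (S R : List Bool → Set V)
    (z : List Bool → V) : Prop where
  conn : ∀ w, w.length < N → G.IsConn (R w)
  root_mem : ∀ w, w.length < N → z w ∈ R w
  branch_subset : ∀ w, w.length < N → R w ⊆ S w
  subset : ∀ b w, w.length < N → S (b :: w) ⊆ S w
  disjoint : ∀ b w, w.length < N → Disjoint (R w) (S (b :: w))
  adj : ∀ b w, w.length < N → ∃ r ∈ R w, G.Adj r (z (b :: w))
  anticomplete : ∀ w, w.length < N → ∀ a ∈ S (true :: w), ∀ c ∈ S (false :: w), a ≠ c ∧ ¬ G.Adj a c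
  few : ∀ w, {v | v ∉ S w ∧ ∃ a ∈ S w, G.Adj a v}.ncard < τ

section BranchSystem

variable {V : Type*} {G : SimpleGraph V} {N τ : ℕ} {S R : List Bool → Set V} {z : List Bool → V}
  {u v w : List Bool}

/-- Some vertex of `R u` has a neighbour in `S v`, where `v` is a proper extension of `u`. -/
def BranchSees (G : SimpleGraph V) (S R : List Bool → Set V) (u v : List Bool) : Prop :=
  u <:+ v ∧ u ≠ v ∧ ∃ a ∈ R u, ∃ c ∈ S v, G.Adj a c

namespace IsBranchSystem

theorem subset_of_suffix (h : G.IsBranchSystem N τ S R z) (huv : u <:+ v) (hv : v.length ≤ N) :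
    S v ⊆ S u := by
  induction v with
  | nil => rw [List.suffix_nil.1 huv]
  | cons b v ih =>
    rcases List.suffix_cons_iff.1 huv with rfl | huv
    · exact subset_rfl
    · simp only [List.length_cons] at hv
      exact (h.subset b v (by omega)).trans (ih huv (by omega))

theorem disjoint_of_suffix (h : G.IsBranchSystem N τ S R z) (huv : u <:+ v) (hne : u ≠ v)
    (hv : v.length ≤ N) : Disjoint (R u) (S v) := by
  obtain ⟨b, hb⟩ := exists_cons_suffix huv hne
  have := hb.length_le
  simp only [List.length_cons] at this
  exact (h.disjoint b u (by omega)).mono_right (h.subset_of_suffix hb hv)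

theorem anticomplete_of_suffix (h : G.IsBranchSystem N τ S R z) {b : Bool}
    (hu : b :: w <:+ u) (hv : (!b) :: w <:+ v) (huN : u.length < N) (hvN : v.length < N)
    {a c : V} (ha : a ∈ R u) (hc : c ∈ R v) : a ≠ c ∧ ¬ G.Adj a c := by
  have ha' := h.subset_of_suffix hu huN.le (h.branch_subset u huN ha)
  have hc' := h.subset_of_suffix hv hvN.le (h.branch_subset v hvN hc)
  have hw := hu.length_le
  simp only [List.length_cons] at hw
  cases b
  · have := h.anticomplete w (by omega) c hc' a ha'
    exact ⟨this.1.symm, fun h => this.2 h.symm⟩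
  · exact h.anticomplete w (by omega) a ha' c hc'

/-- Each seen `u` supplies a neighbour of `S v` lying in `R u` and outside `S v`; these are distinct
because the sets `R` along a branch are disjoint. -/
theorem few_sees [Finite V] (h : G.IsBranchSystem N τ S R z) (hv : v.length < N) :
    {u | G.BranchSees S R u v}.Finite ∧ {u | G.BranchSees S R u v}.ncard < τ := by
  have hex : ∀ u ∈ {u | G.BranchSees S R u v}, ∃ a ∈ R u, ∃ c ∈ S v, G.Adj a c :=
    fun u hu => hu.2.2
  have : Nonempty V := ⟨z []⟩
  choose! e he1 he2 using hex
  have hmaps : ∀ u ∈ {u | G.BranchSees S R u v},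
      e u ∈ {x | x ∉ S v ∧ ∃ a ∈ S v, G.Adj a x} := by
    intro u hu
    obtain ⟨c, hc, hadj⟩ := he2 u hu
    exact ⟨Set.disjoint_left.1 (h.disjoint_of_suffix hu.1 hu.2.1 hv.le) (he1 u hu),
      c, hc, hadj.symm⟩
  have hlt : ∀ u ∈ {u | G.BranchSees S R u v}, ∀ u' ∈ {u | G.BranchSees S R u v},
      u.length ≤ u'.length → e u = e u' → u = u' := by
    intro u hu u' hu' hl heq
    by_contra hne
    have hN := hu'.1.length_le
    have hd := h.disjoint_of_suffix (List.suffix_of_suffix_length_le hu.1 hu'.1 hl) hne (by omega)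
    exact Set.disjoint_left.1 hd (he1 u hu)
      (heq ▸ h.branch_subset u' (by omega) (he1 u' hu'))
  have hinj : Set.InjOn e {u | G.BranchSees S R u v} := by
    intro u hu u' hu' heq
    rcases le_total u.length u'.length with hl | hl
    · exact hlt u hu u' hu' hl heq
    · exact (hlt u' hu' u hu hl heq.symm).symm
  have hfin : {u | G.BranchSees S R u v}.Finite :=
    Set.Finite.of_injOn hmaps hinj (Set.toFinite _)
  exact ⟨hfin, (Set.ncard_le_ncard_of_injOn e hmaps hinj (Set.toFinite _)).trans_lt (h.few v)⟩

theorem isConn_iUnion (h : G.IsBranchSystem N τ S R z) (huv : u <:+ v) (hv : v.length < N) :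
    G.IsConn (⋃ t ∈ {t | u <:+ t ∧ t <:+ v}, R t) := by
  induction v with
  | nil =>
    obtain rfl := List.suffix_nil.1 huv
    have : (⋃ t ∈ {t : List Bool | [] <:+ t ∧ t <:+ []}, R t) = R [] := by simp
    rw [this]
    exact h.conn _ hv
  | cons b v ih =>
    rcases List.suffix_cons_iff.1 huv with rfl | huv
    · have : (⋃ t ∈ {t : List Bool | b :: v <:+ t ∧ t <:+ b :: v}, R t) = R (b :: v) := by
        ext x
        simp only [Set.mem_iUnion, Set.mem_ofPred_eq, exists_prop]
        refine ⟨?_, fun hx => ⟨_, ⟨List.suffix_rfl, List.suffix_rfl⟩, hx⟩⟩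
        rintro ⟨t, ⟨h1, h2⟩, hx⟩
        rwa [h1.eq_of_length_le h2.length_le]
      rw [this]
      exact h.conn _ hv
    · have hvN : v.length < N := by simp only [List.length_cons] at hv; omega
      obtain ⟨r, hr, hadj⟩ := h.adj b v hvN
      have : (⋃ t ∈ {t : List Bool | u <:+ t ∧ t <:+ b :: v}, R t) =
          (⋃ t ∈ {t : List Bool | u <:+ t ∧ t <:+ v}, R t) ∪ R (b :: v) := by
        ext x
        simp only [Set.mem_iUnion, Set.mem_ofPred_eq, exists_prop, Set.mem_union,
          List.suffix_cons_iff]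
        constructor
        · rintro ⟨t, ⟨h1, rfl | h2⟩, hx⟩
          · exact Or.inr hx
          · exact Or.inl ⟨t, ⟨h1, h2⟩, hx⟩
        · rintro (⟨t, ⟨h1, h2⟩, hx⟩ | hx)
          · exact ⟨t, ⟨h1, Or.inr h2⟩, hx⟩
          · exact ⟨b :: v, ⟨huv.trans (List.suffix_cons _ _), Or.inl rfl⟩, hx⟩
      rw [this]
      refine (ih huv hvN).union (h.conn _ hv) ?_ (h.root_mem _ hv) hadj
      simp only [Set.mem_iUnion]
      exact ⟨v, ⟨huv, List.suffix_rfl⟩, hr⟩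

/-- A branch system with sufficiently many levels contains an induced binary tree model. -/
theorem hasInducedMinor [Finite V] (h : G.IsBranchSystem N τ S R z) (ρ : ℕ)
    (hN : levels τ ρ ≤ N) : G.HasInducedMinor (binaryTree ρ) := by
  obtain ⟨ℓ, h1, h2, h3⟩ := exists_unseen_segments (G.BranchSees S R) (M := τ) (N := N)
    (fun v hv => h.few_sees hv) ρ [] (by simpa using hN)
  have hlen : ∀ σ, σ.length ≤ ρ → (ℓ σ).length < N := fun σ hσ => by
    have := (h1 σ hσ).2
    simp only [List.length_nil] at this
    omega
  have hsegle : ∀ σ u, u ∈ wordSegment ℓ σ → u <:+ ℓ σ := by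
    rintro (_ | ⟨i, σ⟩) u hu
    · rw [Set.mem_singleton_iff.1 hu]
    · exact hu.2
  have hself : ∀ σ, σ.length ≤ ρ → ℓ σ ∈ wordSegment ℓ σ := by
    rintro (_ | ⟨i, σ⟩) hσ
    · exact rfl
    · exact ⟨h2 i σ hσ, List.suffix_rfl⟩
  have hmono : ∀ τ, τ.length ≤ ρ → ∀ σ, σ <:+ τ → ℓ σ <:+ ℓ τ := by
    intro τ
    induction τ with
    | nil => exact fun _ σ hσ => by rw [List.suffix_nil.1 hσ]
    | cons b τ ih =>
      intro hτ σ hσ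
      rcases List.suffix_cons_iff.1 hσ with rfl | hσ
      · exact List.suffix_rfl
      · exact (ih (Nat.le_of_succ_le hτ) σ hσ).trans ((List.suffix_cons _ _).trans (h2 b τ hτ))
  have hstart : ∀ b w σ, σ.length ≤ ρ → b :: w <:+ σ → ∀ u ∈ wordSegment ℓ σ, b :: ℓ w <:+ u := by
    rintro b w (_ | ⟨i, σ⟩) hσ hw u hu
    · simp at hw
    · rcases List.suffix_cons_iff.1 hw with heq | hw
      · obtain ⟨rfl, rfl⟩ := List.cons.inj heq
        exact hu.1
      · have hσ' : σ.length ≤ ρ := Nat.le_of_succ_le hσ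
        have hwl := hw.length_le
        simp only [List.length_cons] at hwl
        exact ((h2 b w (by omega)).trans (hmono σ hσ' _ hw)).trans
          ((List.suffix_cons _ _).trans hu.1)
  have hseglen : ∀ σ, σ.length ≤ ρ → ∀ u ∈ wordSegment ℓ σ, u.length < N := fun σ hσ u hu =>
    (hsegle σ u hu).length_le.trans_lt (hlen σ hσ)
  have hincomp : ∀ σ τ : List Bool, σ.length ≤ ρ → τ.length ≤ ρ → ¬ σ <:+ τ → ¬ τ <:+ σ →
      ∀ u ∈ wordSegment ℓ σ, ∀ v ∈ wordSegment ℓ τ, ∀ a ∈ R u, ∀ c ∈ R v, a ≠ c ∧ ¬ G.Adj a c := by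
    intro σ τ hσ hτ hστ hτσ u hu v hv a ha c hc
    obtain ⟨w, b, hw, hw'⟩ := exists_cons_suffix_of_not_suffix hστ hτσ
    exact h.anticomplete_of_suffix (hstart b w σ hσ hw u hu) (hstart _ w τ hτ hw' v hv)
      (hseglen σ hσ u hu) (hseglen τ hτ v hv) ha hc
  have hdisj : ∀ σ τ : List Bool, τ.length ≤ ρ → σ <:+ τ → σ ≠ τ →
      ∀ u ∈ wordSegment ℓ σ, ∀ v ∈ wordSegment ℓ τ, ∀ a ∈ R u, ∀ c ∈ R v, a ≠ c := by
    rintro σ τ hτ hστ hne u hu v hv a ha c hc rfl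
    obtain ⟨b, hb⟩ := exists_cons_suffix hστ hne
    have h4 := hstart b σ τ hτ hb v hv
    have h5 := hsegle σ u hu
    have huv : u <:+ v := h5.trans ((List.suffix_cons _ _).trans h4)
    have h6 := h4.length_le
    have h7 := h5.length_le
    simp only [List.length_cons] at h6
    have hvN := hseglen τ hτ v hv
    refine Set.disjoint_left.1 (h.disjoint_of_suffix huv ?_ hvN.le) ha (h.branch_subset v hvN hc)
    rintro rfl
    omega
  -- If `σ` lies strictly above the parent of `τ`, then `R v` is contained in `S` at the image of
  -- that parent, which sees nothing in the segment of `σ`.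
  have hadj : ∀ σ τ : List Bool, τ.length ≤ ρ → σ <:+ τ → σ ≠ τ →
      ∀ u ∈ wordSegment ℓ σ, ∀ v ∈ wordSegment ℓ τ, ∀ a ∈ R u, ∀ c ∈ R v, G.Adj a c →
        ∃ b, τ = b :: σ := by
    rintro σ (_ | ⟨b, τ⟩) hτ hστ hne u hu v hv a ha c hc hac
    · exact absurd (List.suffix_nil.1 hστ) hne
    rcases List.suffix_cons_iff.1 hστ with heq | hστ
    · exact absurd heq hne
    by_cases heq : σ = τ
    · exact ⟨b, by rw [heq]⟩
    have hτ' : τ.length ≤ ρ := Nat.le_of_succ_le hτ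
    obtain ⟨i, hi⟩ := exists_cons_suffix hστ heq
    have h4 := hstart i σ τ hτ' hi _ (hself τ hτ')
    have h5 := hsegle σ u hu
    have h6 := h4.length_le
    have h7 := h5.length_le
    simp only [List.length_cons] at h6
    refine absurd ⟨h5.trans ((List.suffix_cons _ _).trans h4), ?_, a, ha, c, ?_, hac⟩
      (h3 τ hτ' σ hστ heq u hu)
    · rintro rfl
      omega
    · have hvN := hseglen _ hτ v hv
      exact h.subset_of_suffix ((List.suffix_cons _ _).trans hv.1) hvN.le
        (h.branch_subset v hvN hc)
  refine ⟨fun σ => ⋃ u ∈ wordSegment ℓ σ.1, R u, ?_, ?_, ?_⟩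
  · rintro ⟨σ, hσ⟩
    have hmem : z (ℓ σ) ∈ ⋃ u ∈ wordSegment ℓ σ, R u := by
      simp only [Set.mem_iUnion]
      exact ⟨ℓ σ, hself σ hσ, h.root_mem _ (hlen σ hσ)⟩
    refine IsConn.induce_connected ?_ hmem
    rcases σ with _ | ⟨i, σ⟩
    · simpa [wordSegment] using h.conn _ (hlen [] hσ)
    · exact h.isConn_iUnion (h2 i σ hσ) (hlen _ hσ)
  · rintro ⟨σ, hσ⟩ ⟨τ, hτ⟩ hne
    have hne' : σ ≠ τ := fun h => hne (Subtype.ext h)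
    rw [Set.disjoint_left]
    intro a ha hc
    simp only [Set.mem_iUnion] at ha hc
    obtain ⟨u, hu, ha⟩ := ha
    obtain ⟨v, hv, hc⟩ := hc
    by_cases h5 : σ <:+ τ
    · exact hdisj σ τ hτ h5 hne' u hu v hv a ha a hc rfl
    by_cases h6 : τ <:+ σ
    · exact hdisj τ σ hσ h6 hne'.symm v hv u hu a hc a ha rfl
    · exact (hincomp σ τ hσ hτ h5 h6 u hu v hv a ha a hc).1 rfl
  · have hchild : ∀ (b : Bool) (σ : List Bool), (b :: σ).length ≤ ρ →
        ∃ x ∈ ⋃ u ∈ wordSegment ℓ σ, R u, ∃ y ∈ ⋃ u ∈ wordSegment ℓ (b :: σ), R u, G.Adj x y := by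
      intro b σ hσ
      have hσ' : σ.length ≤ ρ := Nat.le_of_succ_le hσ
      obtain ⟨r, hr, hra⟩ := h.adj b (ℓ σ) (hlen σ hσ')
      have hl := (h2 b σ hσ).length_le.trans_lt (hlen _ hσ)
      refine ⟨r, ?_, z (b :: ℓ σ), ?_, hra⟩ <;> simp only [Set.mem_iUnion]
      · exact ⟨ℓ σ, hself σ hσ', hr⟩
      · exact ⟨b :: ℓ σ, ⟨List.suffix_rfl, h2 b σ hσ⟩, h.root_mem _ hl⟩
    rintro ⟨σ, hσ⟩ ⟨τ, hτ⟩ hne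
    have hne' : σ ≠ τ := fun h => hne (Subtype.ext h)
    constructor
    · rintro (⟨b, hb⟩ | ⟨b, hb⟩)
      · obtain rfl : τ = b :: σ := hb
        exact hchild b σ hτ
      · obtain rfl : σ = b :: τ := hb
        obtain ⟨x, hx, y, hy, hxy⟩ := hchild b τ hσ
        exact ⟨y, hy, x, hx, hxy.symm⟩
    · rintro ⟨a, ha, c, hc, hac⟩
      simp only [Set.mem_iUnion] at ha hc
      obtain ⟨u, hu, ha⟩ := ha
      obtain ⟨v, hv, hc⟩ := hc
      by_cases h5 : σ <:+ τ
      · exact Or.inl (hadj σ τ hτ h5 hne' u hu v hv a ha c hc hac)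
      by_cases h6 : τ <:+ σ
      · exact Or.inr (hadj τ σ hσ h6 hne'.symm v hv u hu c hc a ha hac.symm)
      · exact absurd hac (hincomp σ τ hσ hτ h5 h6 u hu v hv a ha c hc).2

end IsBranchSystem

end BranchSystem

/-! ### From large pathwidth to a branch system, and the final bound. -/

theorem exists_isBranchSystem {V : Type*} [Finite V] {G : SimpleGraph V} {f : V → ℕ} {τ : ℕ}
    (hf : f.Injective) (hτ : ∀ x, (G.attach f x).ncard < τ) (N : ℕ) {x : V}
    (hx : ¬ G.HasLayout (G.lower f x) (6 * τ * N)) :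
    ∃ S R z, G.IsBranchSystem N τ S R z := by
  have H : ∀ (s : ℕ) (p : V × V), p.2 ∈ G.lower f p.1 →
      ¬ G.HasLayout (G.lower f p.1) (s + 6 * τ) →
      ∃ (q : Bool → V × V) (R : Set V), G.IsConn R ∧ p.2 ∈ R ∧ R ⊆ G.lower f p.1 ∧
        (∀ b, G.lower f (q b).1 ⊆ G.lower f p.1) ∧
        Disjoint (G.lower f (q true).1) (G.lower f (q false).1) ∧
        (∀ b, Disjoint R (G.lower f (q b).1)) ∧
        (∀ b, ¬ G.HasLayout (G.lower f (q b).1) s) ∧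
        ∀ b, (q b).2 ∈ G.lower f (q b).1 ∧ ∃ r ∈ R, G.Adj r (q b).2 := by
    intro s p hp hh
    by_contra hcon
    refine hh (hasLayout_lower_of_not_hasBranching hf hτ hp ?_)
    rintro ⟨y, t, R, hR⟩
    exact hcon ⟨fun b => (y b, t b), R, hR⟩
  choose! q R hq using H
  -- A state is a vertex defining a set `lower` together with the entry vertex from which the next
  -- branching must start. Each level spends `6 * τ` of heaviness.
  let st : List Bool → V × V := fun w =>
    List.rec (x, x) (fun b w p => q (6 * τ * (N - w.length - 1)) p b) w
  have hst : ∀ w : List Bool, w.length ≤ N → (st w).2 ∈ G.lower f (st w).1 ∧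
      ¬ G.HasLayout (G.lower f (st w).1) (6 * τ * (N - w.length)) := by
    intro w
    induction w with
    | nil => exact fun _ => ⟨mem_lower_self, hx⟩
    | cons b w ih =>
      intro hw
      simp only [List.length_cons] at hw
      obtain ⟨h1, h2⟩ := ih (by omega)
      have h3 : N - w.length = N - w.length - 1 + 1 := by omega
      rw [h3, mul_add, mul_one] at h2
      obtain ⟨-, -, -, -, -, -, h4, h5⟩ := hq _ _ h1 h2
      exact ⟨(h5 b).1, h4 b⟩
  have hR : ∀ w : List Bool, w.length < N → _ := fun w hw =>
    hq (6 * τ * (N - w.length - 1)) (st w) (hst w hw.le).1 (by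
      have h2 := (hst w hw.le).2
      have h3 : N - w.length = N - w.length - 1 + 1 := by omega
      rwa [h3, mul_add, mul_one] at h2)
  refine ⟨fun w => G.lower f (st w).1, fun w => R (6 * τ * (N - w.length - 1)) (st w),
    fun w => (st w).2, fun w hw => (hR w hw).1, fun w hw => (hR w hw).2.1,
    fun w hw => (hR w hw).2.2.1, fun b w hw => (hR w hw).2.2.2.1 b,
    fun b w hw => (hR w hw).2.2.2.2.2.1 b, fun b w hw => ((hR w hw).2.2.2.2.2.2.2 b).2,
    fun w hw a ha c hc => ?_, fun w => hτ _⟩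
  have hd := (hR w hw).2.2.2.2.1
  exact ⟨fun h => Set.disjoint_left.1 hd ha (h ▸ hc), not_adj_of_lower_disjoint hd ha hc⟩

theorem pathwidth_le_of_not_hasInducedMinor {V : Type*} [Finite V] {G : SimpleGraph V} {ρ τ : ℕ}
    (htw : G.treewidth < τ) (hG : ¬ G.HasInducedMinor (binaryTree ρ)) :
    G.pathwidth ≤ 6 * τ * levels τ ρ := by
  obtain ⟨n, T, β, hT, hβ⟩ := G.hasTreewidthAtMost_treewidth
  obtain ⟨f, hf, hτ⟩ := hT.exists_rank (τ := τ) fun x => (hβ x).trans htw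
  refine Nat.sInf_le (HasLayout.hasPathwidthAtMost (hasLayout_of_lower (f := f) fun x _ => ?_))
  by_contra hx
  obtain ⟨S, R, z, h⟩ := exists_isBranchSystem hf hτ _ hx
  exact hG (h.hasInducedMinor ρ le_rfl)

theorem pathwidth_eq_zero_of_treewidth {V : Type*} [Finite V] {G : SimpleGraph V}
    (htw : G.treewidth = 0) : G.pathwidth = 0 := by
  obtain ⟨n, T, β, hT, hβ⟩ := G.hasTreewidthAtMost_treewidth
  refine Nat.le_zero.1 (Nat.sInf_le (HasLayout.hasPathwidthAtMost ?_))
  have hadj : ∀ u v, ¬ G.Adj u v := by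
    intro u v huv
    obtain ⟨x, hu, hv⟩ := hT.exists_bag u v huv
    exact huv.ne (Finset.card_le_one.1 ((hβ x).trans (by omega)) u hu v hv)
  have hfr : ∀ W, G.frontierIn Set.univ W = ∅ := fun W =>
    Set.eq_empty_of_forall_notMem fun v ⟨_, u, _, _, h⟩ => hadj v u h
  have hsweep : ∀ W, G.Sweep Set.univ 0 W := by
    intro W
    induction W, Set.toFinite W using Set.Finite.induction_on with
    | empty => exact Sweep.empty
    | insert _ _ ih => exact ih.insert (Set.mem_univ _) (by rw [hfr, Set.ncard_empty])
  exact hsweep _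

end SimpleGraph

theorem mainTheorem5 (ρ τ : ℕ) (hρ : 1 ≤ ρ) (hτ : 1 ≤ τ) {V : Type*} [Finite V]
    (G : SimpleGraph V) (htw : G.treewidth < τ)
    (hG : ¬ G.HasInducedMinor (SimpleGraph.binaryTree ρ)) :
    G.pathwidth < τ ^ (6 * ρ + 2) := by
  rcases hτ.eq_or_lt with rfl | hτ
  -- For `τ = 1` the claim is pathwidth `0`, which the general estimate does not give.
  · simpa using SimpleGraph.pathwidth_eq_zero_of_treewidth (by omega)
  · have h1 := SimpleGraph.pathwidth_le_of_not_hasInducedMinor htw hG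
    have h2 := levels_lt hτ ρ
    calc G.pathwidth ≤ 6 * τ * levels τ ρ := h1
      _ < 6 * τ * τ ^ (ρ + 1) := Nat.mul_lt_mul_of_pos_left h2 (by omega)
      -- The factor `6` is absorbed by `τ ^ 3 ≥ 8`.
      _ ≤ τ ^ 3 * τ * τ ^ (ρ + 1) := by
        have : 2 ^ 3 ≤ τ ^ 3 := Nat.pow_le_pow_left hτ 3
        gcongr
        omega
      _ = τ ^ (ρ + 5) := by ring
      _ ≤ τ ^ (6 * ρ + 2) := Nat.pow_le_pow_right (by omega) (by omega)
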